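/- **Setting.** Let $\mathcal K=\{1,\dots,K\}$ be a finite set of actions. On a probability space $(\Omega,\mathcal F,\mathbb P)$ let $p^*$ be a random probability distribution on $[0,1]^{K}$ (drawn from an arbitrary prior), and let $\boldsymbol Y_t=(Y_{t,a})_{a\in\mathcal K}\in[0,1]^K$, $t\ge 1$, be reward vectors that, conditionally on $p^*$, are independent and identically distributed with law $p^*$. Let $A^*$ be an optimal action, i.e. a measurable function of $p^*$ with $A^*\in\arg\max_{a\in\mathcal K}\mathbb E[Y_{t,a}\mid p^*]$ almost surely. Let $G_1,G_2,\dots$ be an arbitrary deterministic sequence of directed graphs on $\mathcal K$, each of which contains all self-loops; write $j\overset{t}{\to}i$ if $(j,i)$ is an arc of $G_t$. In round $t$ the decision maker plays an action $A_t$ and observes $Y_{t,a}$ for all $a$ with $A_t\overset{t}{\to}a$. Let $\mathcal F_t$ be the $\sigma$-algebra generated by the actions and observations of rounds $1,\dots,t-1$, let $\boldsymbol\alpha_t(a)=\mathbb P(A^*=a\mid\mathcal F_t)$ be the posterior distribution of $A^*$ (so $\boldsymbol\alpha_1$ is its prior distribution), let $H(\boldsymbol\alpha_1)=-\sum_{a}\boldsymbol\alpha_1(a)\log\boldsymbol\alpha_1(a)$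 be its Shannon entropy (natural logarithm, $0\log 0=0$), and for a probability vector $\boldsymbol\pi$ on $\mathcal K$ put $$Q_t(\boldsymbol\pi)=\sum_{i\in\mathcal K}\frac{\boldsymbol\pi(i)}{\sum_{j:\,j\overset{t}{\to}i}\boldsymbol\pi(j)}\qquad(\text{with } 0/0=0).$$ The algorithm TS-N (Thompson Sampling without knowledge of the graphs) draws $A_t$ from $\boldsymbol\pi_t=\boldsymbol\alpha_t$ in every round $t$, with randomness that is conditionally independent of $(p^*,\boldsymbol Y_1,\boldsymbol Y_2,\dots)$ given $\mathcal F_t$; that is, $\mathbb P(A_t=a\mid\mathcal F_t,p^*,\boldsymbol Y_1,\boldsymbol Y_2,\dots)=\boldsymbol\alpha_t(a)$ almost surely for all $a$. **Theorem.** For every $T\ge 0$, the Bayesian regret of TS-N satisfies $$\mathbb E\Big[\sum_{t=1}^{T}\big(Y_{t,A^*}-Y_{t,A_t}\big)\Big]\;\le\;\sqrt{\frac12\Big(\sum_{t=1}^{T}\mathbb E\big[Q_t(\boldsymbol\alpha_t)\big]\Big)\,H(\boldsymbol\alpha_1)}\,.$$ -/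

import Mathlib

open MeasureTheory ProbabilityTheory
open scoped BigOperators

noncomputable section

/-- A reward vector `(y_a)_a`, one reward in `[0,1]` for each of the `K` actions. -/
abbrev RewardVec (K : ℕ) : Type := Fin K → unitInterval

/-- The Shannon entropy (natural logarithm, `0 log 0 = 0`) of a vector of probabilities. -/
def shannonEntropy {K : ℕ} (q : Fin K → ℝ) : ℝ :=
  -∑ i, q i * Real.log (q i)

open Classical in
/-- `Q_G(q) = ∑ i, q i / ∑_{j → i in G} q j`, where a summand `0 / 0` counts as `0`. -/
def graphQ {K : ℕ} (G : Digraph (Fin K)) (q : Fin K → ℝ) : ℝ :=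
  ∑ i, q i / ∑ j ∈ Finset.univ.filter (fun j => G.Adj j i), q j

/-- The mean reward of action `a` under the reward distribution `p`. -/
def meanReward {K : ℕ} (p : Measure (RewardVec K)) (a : Fin K) : ℝ :=
  ∫ y, (y a : ℝ) ∂p

/-- The objects of a `K`-armed bandit with graph feedback, over a sample space `Ω`.
Rounds are numbered `0, 1, 2, …`. -/
structure GraphBandit (K : ℕ) (Ω : Type*) where
  /-- the (deterministic, latent, directed) feedback graph of round `t`: an arc `i → j` means that
  playing `i` reveals the reward of `j` -/
  graph : ℕ → Digraph (Fin K)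
  /-- the random true reward distribution `p*` -/
  pstar : Ω → Measure (RewardVec K)
  /-- the reward vector `Y_t` of round `t` -/
  reward : ℕ → Ω → RewardVec K
  /-- the optimal action `A*` -/
  optAction : Ω → Fin K
  /-- the action `A_t` played in round `t` -/
  action : ℕ → Ω → Fin K

namespace GraphBandit

variable {K : ℕ} {Ω : Type*}

/-- The σ-algebra generated by the true reward distribution `p*`. -/
abbrev sigmaPstar (B : GraphBandit K Ω) : MeasurableSpace Ω :=
  MeasurableSpace.comap B.pstar inferInstance

/-- The σ-algebra generated by `p*` and all the reward vectors (observed or not). -/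
abbrev sigmaEnv (B : GraphBandit K Ω) : MeasurableSpace Ω :=
  B.sigmaPstar ⊔ ⨆ s, MeasurableSpace.comap (B.reward s) inferInstance

open Classical in
/-- What the decision maker sees in round `s`: the action `A_s`, and `Y_{s,a}` for every `a` with
`A_s → a`. The entries of the other actions are blanked out (set to `0`). As the graph is
deterministic, `A_s` determines which entries these are, so the filler carries no information. -/
def observation (B : GraphBandit K Ω) (s : ℕ) (ω : Ω) : Fin K × RewardVec K :=
  (B.action s ω, fun a => if (B.graph s).Adj (B.action s ω) a then B.reward s ω a else 0)

/-- The σ-algebra `F_t` generated by the observations of all the rounds before `t`. -/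
abbrev hist (B : GraphBandit K Ω) (t : ℕ) : MeasurableSpace Ω :=
  ⨆ s : Fin t, MeasurableSpace.comap (B.observation s) inferInstance

variable [MeasurableSpace Ω]

/-- The assumptions of the Bayesian bandit model with graph feedback. -/
structure IsBayesian (B : GraphBandit K Ω) (P : Measure Ω) : Prop where
  /-- every graph contains all the self-loops: the reward of the played action is observed -/
  adj_self : ∀ t i, (B.graph t).Adj i i
  measurable_pstar : Measurable B.pstar
  isProbabilityMeasure_pstar : ∀ ω, IsProbabilityMeasure (B.pstar ω)
  measurable_reward : ∀ t, Measurable (B.reward t)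
  measurable_action : ∀ t, Measurable (B.action t)
  /-- conditionally on `p*`, the reward vectors are independent and all have the law `p*` -/
  iid_reward : ∀ (n : ℕ) (S : ℕ → Set (RewardVec K)), (∀ t, MeasurableSet (S t)) →
    P⟦⋂ t ∈ Finset.range n, B.reward t ⁻¹' S t | B.sigmaPstar⟧
      =ᵐ[P] fun ω => ∏ t ∈ Finset.range n, (B.pstar ω).real (S t)
  /-- `A*` is a function of `p*` … -/
  measurable_optAction : Measurable[B.sigmaPstar] B.optAction
  /-- … and it maximizes the mean reward under `p*` -/
  optAction_optimal : ∀ᵐ ω ∂P, ∀ a,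
    meanReward (B.pstar ω) a ≤ meanReward (B.pstar ω) (B.optAction ω)

/-- The prior distribution of `A*`. -/
def prior (B : GraphBandit K Ω) (P : Measure Ω) (a : Fin K) : ℝ :=
  P.real (B.optAction ⁻¹' {a})

/-- The posterior distribution `α_t(a) = ℙ(A* = a | F_t)` of `A*` at the start of round `t`. -/
def posterior (B : GraphBandit K Ω) (P : Measure Ω) (t : ℕ) (a : Fin K) : Ω → ℝ :=
  P⟦B.optAction ⁻¹' {a} | B.hist t⟧

/-- The actions are drawn from the randomized policy `π`: `π_t` is `F_t`-measurable, and `A_t` is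
drawn from `π_t` with randomness that depends on the environment `(p*, Y_0, Y_1, …)` only through
the history, i.e. `ℙ(A_t = a | F_t, p*, Y_0, Y_1, …) = π_t(a) = ℙ(A_t = a | F_t)`. -/
structure FollowsPolicy (B : GraphBandit K Ω) (P : Measure Ω) (π : ℕ → Fin K → Ω → ℝ) :
    Prop where
  adapted : ∀ t a, Measurable[B.hist t] (π t a)
  sampled : ∀ t a, P⟦B.action t ⁻¹' {a} | B.hist t ⊔ B.sigmaEnv⟧ =ᵐ[P] π t a

/-- Thompson Sampling without knowledge of the graphs: the policy `π_t = α_t`. -/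
def IsTSN (B : GraphBandit K Ω) (P : Measure Ω) : Prop :=
  B.FollowsPolicy P (B.posterior P)

/-- The Bayesian regret `𝔼[∑_{t < T} (Y_{t,A*} - Y_{t,A_t})]` of the first `T` rounds. -/
def bayesRegret (B : GraphBandit K Ω) (P : Measure Ω) (T : ℕ) : ℝ :=
  ∫ ω, ∑ t ∈ Finset.range T,
    ((B.reward t ω (B.optAction ω) : ℝ) - (B.reward t ω (B.action t ω) : ℝ)) ∂P

end GraphBandit

end

noncomputable section

/-! Information-ratio argument, one action at a time. Let `α` be the posterior weight of `a` in
round `t`, `q` the conditional probability that the reward of `a` is revealed, and `δ` the shift of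
its conditional mean caused by also conditioning on `A* = a`. Since `A_t` is drawn from the
posterior independently of the environment given the history, the regret of the round is `∑ a, 𝔼[α
δ]`. Completing a square gives `α δ ≤ (c/2) α/q + (1/(2c)) q δ² α` for every `c > 0`, and the terms
`α/q` add up to the graph quantity.

The terms `q δ² α` are paid for by information: `two_mul_integral_sq_le_entropy_increment`, a
Pinsker inequality, bounds `2 𝔼[q δ² α]` by the contribution of `a` to the expected drop of
posterior entropy. The factor `q` appears because the reward of `a` informs the posterior only when
it is revealed. No law of the rewards given `A*` is constructed: the inequality compares the
posteriors `α` and `β` before and after the round pointwise and is then integrated.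

In `integral_regret_le` these give a bound for one round. Summing over rounds telescopes the
entropies, and `le_sqrt_of_forall_pos_le` optimizes the constant `c`, which is shared by all rounds.
-/

/-! ### Scalar inequalities: Pinsker's inequality pointwise, and the choice of `c`. -/

/-- A rational lower bound of the logarithm, tangent to it to third order at `1`. -/
theorem rational_le_log {r : ℝ} (hr : 0 < r) :
    1 - 1 / r + 3 * (r - 1) ^ 2 / (2 * r * (r + 2)) ≤ Real.log r := by
  set k : ℝ → ℝ := fun x => Real.log x - (1 - 1 / x + 3 * (x - 1) ^ 2 / (2 * x * (x + 2)))
    with hk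
  -- The cube has the sign of `x - 1`, so `k` decreases up to `1` and increases after it; its
  -- minimum is `k 1 = 0`.
  have hderiv : ∀ x, 0 < x → HasDerivAt k ((x - 1) ^ 3 / (x ^ 2 * (x + 2) ^ 2)) x := by
    intro x hx
    have hx0 : x ≠ 0 := hx.ne'
    have h2 : x + 2 ≠ 0 := by positivity
    have hne : 2 * x * (x + 2) ≠ 0 := by positivity
    have hid := hasDerivAt_id' x
    have h1 := (((hasDerivAt_const x (1 : ℝ)).sub
      ((hasDerivAt_const x (1 : ℝ)).div hid hx0)).add
      ((((hid.sub_const 1).pow 2).const_mul 3).div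
        ((hid.const_mul 2).mul (hid.add_const 2)) hne))
    refine ((Real.hasDerivAt_log hx0).sub h1).congr_deriv ?_
    simp
    field_simp
    ring
  have hk1 : k 1 = 0 := by simp [hk]
  have hcont : ∀ s ⊆ Set.Ioi (0 : ℝ), ContinuousOn k s := fun s hs x hx =>
    (hderiv x (hs hx)).continuousAt.continuousWithinAt
  suffices 0 ≤ k r by simp only [hk] at this; linarith
  rw [← hk1]
  rcases le_total r 1 with h | h
  · refine antitoneOn_of_deriv_nonpos (convex_Icc r 1)
      (hcont _ fun x hx => lt_of_lt_of_le hr hx.1) ?_ ?_ ⟨le_rfl, h⟩ ⟨h, le_rfl⟩ h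
    · intro x hx
      rw [interior_Icc] at hx
      exact (hderiv x (hr.trans hx.1)).differentiableAt.differentiableWithinAt
    · intro x hx
      rw [interior_Icc] at hx
      rw [(hderiv x (hr.trans hx.1)).deriv]
      refine div_nonpos_of_nonpos_of_nonneg ?_ (by positivity)
      exact Odd.pow_nonpos (by decide) (by linarith [hx.2])
  · refine monotoneOn_of_deriv_nonneg (convex_Icc 1 r)
      (hcont _ fun x hx => lt_of_lt_of_le one_pos hx.1) ?_ ?_ ⟨le_rfl, h⟩ ⟨h, le_rfl⟩ h
    · intro x hx
      rw [interior_Icc] at hx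
      exact (hderiv x (one_pos.trans hx.1)).differentiableAt.differentiableWithinAt
    · intro x hx
      rw [interior_Icc] at hx
      rw [(hderiv x (one_pos.trans hx.1)).deriv]
      have : 0 ≤ x - 1 := by linarith [hx.1]
      positivity

/-- The pointwise inequality behind Pinsker's inequality. -/
theorem sq_sub_le_mul_klDiv {x y : ℝ} (hx : 0 < x) (hy : 0 ≤ y) :
    3 * (y - x) ^ 2 ≤
      (2 * y + 4 * x) * (y * Real.log y - y * Real.log x - y + x) := by
  rcases hy.eq_or_lt with rfl | hy
  · simp
    nlinarith
  · have h := rational_le_log (div_pos hy hx)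
    rw [Real.log_div hy.ne' hx.ne'] at h
    have h2 : y * (1 - 1 / (y / x) + 3 * (y / x - 1) ^ 2 / (2 * (y / x) * (y / x + 2)))
        = y - x + 3 * (y - x) ^ 2 / (2 * y + 4 * x) := by
      field_simp
      ring
    have h3 := mul_le_mul_of_nonneg_left h hy.le
    rw [h2] at h3
    have h4 : 3 * (y - x) ^ 2 / (2 * y + 4 * x)
        ≤ y * Real.log y - y * Real.log x - y + x := by linarith
    rw [div_le_iff₀ (by positivity)] at h4
    linarith

theorem klDiv_pointwise_nonneg {x y : ℝ} (hx : 0 < x) (hy : 0 ≤ y) :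
    0 ≤ y * Real.log y - y * Real.log x - y + x := by
  have h := sq_sub_le_mul_klDiv hx hy
  by_contra! hneg
  have : 0 < 2 * y + 4 * x := by positivity
  nlinarith [sq_nonneg (y - x), mul_pos this (neg_pos.2 hneg)]

/-- Linearized Pinsker inequality, with a free slope `d` so that it can be integrated when `d` is
random. Centring `u` at `1/2` makes `|2(u - 1/2)| ≤ 1`, which yields the sharp constant. When the
averages of `d² y` and `d² x` agree, the quadratic term costs `(2 + 4)/3 = 2` of the `4` gained on
the left. -/
theorem linear_le_sq_add_klDiv {x y d u : ℝ} (hx : 0 < x) (hy : 0 ≤ y) (hu0 : 0 ≤ u)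
    (hu1 : u ≤ 1) :
    4 * d * (y - x) * (u - 1 / 2) ≤
      d ^ 2 * (2 * y + 4 * x) / 3 + (y * Real.log y - y * Real.log x - y + x) := by
  have h := sq_sub_le_mul_klDiv hx hy
  have hN : 0 < 2 * y + 4 * x := by positivity
  set N := 2 * y + 4 * x
  set g := y * Real.log y - y * Real.log x - y + x
  have hg : 3 * (y - x) ^ 2 / N ≤ g := by
    rw [div_le_iff₀ hN]; linarith
  have hw : (2 * (u - 1 / 2)) ^ 2 ≤ 1 := by nlinarith
  -- The square that turns the quadratic Pinsker bound into one linear in `y - x`.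
  have hsq : 0 ≤ (d * N - 3 * (y - x) * (2 * (u - 1 / 2))) ^ 2 / (3 * N) := by positivity
  have he : (d * N - 3 * (y - x) * (2 * (u - 1 / 2))) ^ 2 / (3 * N)
      = d ^ 2 * N / 3 - 4 * d * (y - x) * (u - 1 / 2)
        + 3 * (y - x) ^ 2 / N * (2 * (u - 1 / 2)) ^ 2 := by
    field_simp
    ring
  have h5 : 3 * (y - x) ^ 2 / N * (2 * (u - 1 / 2)) ^ 2 ≤ 3 * (y - x) ^ 2 / N * 1 :=
    mul_le_mul_of_nonneg_left hw (by positivity)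
  linarith

/-- After multiplication by `c`, the hypothesis says that a quadratic polynomial in `c` is
nonnegative; its discriminant is `R² - A H / 2`. This covers `A = 0` and `H = 0`, where no optimal
`c > 0` need exist. -/
theorem le_sqrt_of_forall_pos_le {R A H : ℝ}
    (h : ∀ c : ℝ, 0 < c → R ≤ c / 2 * A + H / (4 * c)) (hA : 0 ≤ A) (hH : 0 ≤ H) :
    R ≤ Real.sqrt (1 / 2 * A * H) := by
  rcases le_total R 0 with hR | hR
  · exact hR.trans (Real.sqrt_nonneg _)
  apply Real.le_sqrt_of_sq_le
  have hq : ∀ c : ℝ, 0 ≤ (A / 2) * (c * c) + (-R) * c + H / 4 := by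
    intro c
    rcases le_or_gt c 0 with hc | hc
    -- For `c ≤ 0` every term is nonnegative, because `R ≥ 0` here.
    · nlinarith [mul_nonneg hR (neg_nonneg.2 hc), mul_nonneg hA (mul_self_nonneg c)]
    · have h1 := mul_le_mul_of_nonneg_left (h c hc) hc.le
      have h2 : c * (c / 2 * A + H / (4 * c)) = A / 2 * (c * c) + H / 4 := by
        field_simp
      linarith
  have := discrim_le_zero hq
  simp only [discrim] at this
  nlinarith

/-! ### Conditional expectations and the entropy reduction from one observation. -/

theorem integrable_of_measurable_of_abs_le {Ω : Type*} [MeasurableSpace Ω] {P : Measure Ω}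
    [IsFiniteMeasure P] {f : Ω → ℝ} (C : ℝ) (hf : Measurable f) (h : ∀ ω, |f ω| ≤ C) :
    Integrable f P :=
  Integrable.of_bound hf.aestronglyMeasurable C (ae_of_all _ h)

/-- The defining property of the conditional expectation, tested against bounded functions. -/
theorem integral_mul_eq_of_condExp_ae_eq {Ω : Type*} {m m0 : MeasurableSpace Ω} {P : Measure Ω}
    [IsFiniteMeasure P] (hm : m ≤ m0) {f g h : Ω → ℝ} (C : ℝ) (hg : Measurable[m] g)
    (hgC : ∀ ω, |g ω| ≤ C) (hf : Integrable f P) (hfh : P[f|m] =ᵐ[P] h) :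
    ∫ ω, g ω * h ω ∂P = ∫ ω, g ω * f ω ∂P := by
  have hint : Integrable (g * f) P :=
    hf.bdd_mul (hg.mono hm le_rfl).aestronglyMeasurable (ae_of_all _ hgC)
  have h1 : P[g * f|m] =ᵐ[P] g * P[f|m] :=
    condExp_mul_of_stronglyMeasurable_left hg.stronglyMeasurable hint hf
  calc ∫ ω, g ω * h ω ∂P = ∫ ω, (P[g * f|m]) ω ∂P := by
        refine integral_congr_ae ?_
        filter_upwards [h1, hfh] with ω h1 h2
        rw [h1, Pi.mul_apply, h2]
    _ = ∫ ω, g ω * f ω ∂P := integral_condExp hm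

/-- The expected squared shift of the conditional mean of `Y` caused by conditioning on an event
(with indicator `X`), weighted by the probability `q` that `Y` is revealed, is at most the
contribution of that event to the entropy reduction. -/
theorem two_mul_integral_sq_le_entropy_increment {Ω : Type*} {m m' n m0 : MeasurableSpace Ω}
    {P : Measure Ω} [IsProbabilityMeasure P] (hmm' : m ≤ m') (hm' : m' ≤ m0) (hmn : m ≤ n)
    (hn : n ≤ m0) {X Y W q α β δ : Ω → ℝ}
    (hX : Measurable[n] X) (hY : Measurable[n] Y) (hW : Measurable[m'] W)
    (hWY : Measurable[m'] fun ω => W ω * Y ω)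
    (hq : Measurable[m] q) (hα : Measurable[m] α) (hβ : Measurable[m'] β) (hδ : Measurable[m] δ)
    (hX01 : ∀ ω, X ω ∈ Set.Icc (0 : ℝ) 1) (hY01 : ∀ ω, Y ω ∈ Set.Icc (0 : ℝ) 1)
    (hW01 : ∀ ω, W ω ∈ Set.Icc (0 : ℝ) 1) (hq01 : ∀ ω, q ω ∈ Set.Icc (0 : ℝ) 1)
    (hα01 : ∀ ω, α ω ∈ Set.Icc (0 : ℝ) 1) (hβ01 : ∀ ω, β ω ∈ Set.Icc (0 : ℝ) 1)
    (hδ1 : ∀ ω, |δ ω| ≤ 1)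
    (hWq : P[W|n] =ᵐ[P] q) (hXα : P[X|m] =ᵐ[P] α) (hXβ : P[X|m'] =ᵐ[P] β)
    (hD : P[fun ω => (X ω - α ω) * Y ω|m] =ᵐ[P] fun ω => α ω * δ ω) :
    2 * ∫ ω, q ω * δ ω ^ 2 * α ω ∂P ≤
      (∫ ω, β ω * Real.log (β ω) ∂P) - ∫ ω, α ω * Real.log (α ω) ∂P := by
  have hm : m ≤ m0 := hmm'.trans hm'
  have hX0 := hX.mono hn le_rfl
  have hY0 := hY.mono hn le_rfl
  have hW0 := hW.mono hm' le_rfl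
  have hq0 := hq.mono hm le_rfl
  have hα0 := hα.mono hm le_rfl
  have hβ0 := hβ.mono hm' le_rfl
  have hδ0 := hδ.mono hm le_rfl
  have hqn := hq.mono hmn le_rfl
  have hαn := hα.mono hmn le_rfl
  have hδn := hδ.mono hmn le_rfl
  have hα' := hα.mono hmm' le_rfl
  have hδ' := hδ.mono hmm' le_rfl
  have aX : ∀ ω, |X ω| ≤ 1 := fun ω => abs_le.2 ⟨by linarith [(hX01 ω).1], (hX01 ω).2⟩
  have aY : ∀ ω, |Y ω| ≤ 1 := fun ω => abs_le.2 ⟨by linarith [(hY01 ω).1], (hY01 ω).2⟩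
  have aY2 : ∀ ω, |Y ω - 1 / 2| ≤ 1 := fun ω =>
    abs_le.2 ⟨by linarith [(hY01 ω).1], by linarith [(hY01 ω).2]⟩
  have aW : ∀ ω, |W ω| ≤ 1 := fun ω => abs_le.2 ⟨by linarith [(hW01 ω).1], (hW01 ω).2⟩
  have aq : ∀ ω, |q ω| ≤ 1 := fun ω => abs_le.2 ⟨by linarith [(hq01 ω).1], (hq01 ω).2⟩
  have aα : ∀ ω, |α ω| ≤ 1 := fun ω => abs_le.2 ⟨by linarith [(hα01 ω).1], (hα01 ω).2⟩
  have aβ : ∀ ω, |β ω| ≤ 1 := fun ω => abs_le.2 ⟨by linarith [(hβ01 ω).1], (hβ01 ω).2⟩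
  have m2 : ∀ {x y : ℝ}, |x| ≤ 1 → |y| ≤ 1 → |x * y| ≤ 1 := fun hx hy => by
    rw [abs_mul]; exact mul_le_one₀ hx (abs_nonneg _) hy
  have p2 : ∀ {x : ℝ}, |x| ≤ 1 → |x ^ 2| ≤ 1 := fun hx => by
    rw [sq]; exact m2 hx hx
  have hI : ∀ {f : Ω → ℝ}, Measurable f → (∀ ω, |f ω| ≤ 1) → Integrable f P :=
    fun hf h => integrable_of_measurable_of_abs_le 1 hf h
  -- the log-terms
  have alog : ∀ x : ℝ, x ∈ Set.Icc (0 : ℝ) 1 → |x * Real.log x| ≤ 1 := by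
    intro x hx
    rcases hx.1.eq_or_lt with h0 | h0
    · simp [← h0]
    · rw [mul_comm]; exact (Real.abs_log_mul_self_lt x h0 hx.2).le
  have iβlog : Integrable (fun ω => β ω * Real.log (β ω)) P :=
    hI (by fun_prop) fun ω => alog _ (hβ01 ω)
  have iαlog : Integrable (fun ω => α ω * Real.log (α ω)) P :=
    hI (by fun_prop) fun ω => alog _ (hα01 ω)
  set S := ∫ ω, q ω * δ ω ^ 2 * α ω ∂P with hS
  -- Two conditionings: `β` becomes `X` given `m'`, then `W` becomes `q` given `n`, which knows both
  -- `X` and `Y`.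
  have e1 : ∫ ω, W ω * δ ω * (Y ω - 1 / 2) * β ω ∂P
      = ∫ ω, q ω * δ ω * (Y ω - 1 / 2) * X ω ∂P := by
    rw [integral_mul_eq_of_condExp_ae_eq hm' (f := X) 1 ?_ ?_ (hI hX0 aX) hXβ]
    · have := integral_mul_eq_of_condExp_ae_eq hn (g := fun ω => δ ω * (Y ω - 1 / 2) * X ω) 1
        (by fun_prop) (fun ω => m2 (m2 (hδ1 ω) (aY2 ω)) (aX ω)) (hI hW0 aW) hWq
      convert this.symm using 3 <;> ring
    -- `Y` itself need not be `m'`-measurable; it enters only through `W * Y`.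
    · have : (fun ω => W ω * δ ω * (Y ω - 1 / 2))
          = fun ω => δ ω * (W ω * Y ω) - δ ω * W ω * (1 / 2) := by funext ω; ring
      rw [this]
      exact (hδ'.mul hWY).sub ((hδ'.mul hW).mul_const _)
    · exact fun ω => m2 (m2 (aW ω) (hδ1 ω)) (aY2 ω)
  have e2 : ∫ ω, W ω * δ ω * (Y ω - 1 / 2) * α ω ∂P
      = ∫ ω, q ω * δ ω * (Y ω - 1 / 2) * α ω ∂P := by
    have := integral_mul_eq_of_condExp_ae_eq hn (g := fun ω => δ ω * (Y ω - 1 / 2) * α ω) 1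
        (by fun_prop) (fun ω => m2 (m2 (hδ1 ω) (aY2 ω)) (aα ω)) (hI hW0 aW) hWq
    convert this.symm using 3 <;> ring
  -- The shift by `1/2` drops out because `X - α` has conditional mean zero given `m`.
  have e3 : ∫ ω, q ω * δ ω * (Y ω - 1 / 2) * X ω ∂P - ∫ ω, q ω * δ ω * (Y ω - 1 / 2) * α ω ∂P
      = S := by
    have h1 := integral_mul_eq_of_condExp_ae_eq hm (g := fun ω => q ω * δ ω) 1
      (by fun_prop) (fun ω => m2 (aq ω) (hδ1 ω)) (f := fun ω => (X ω - α ω) * Y ω)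
      (hI (by fun_prop) fun ω => m2 (abs_le.2 ⟨by linarith [(hX01 ω).1, (hα01 ω).2],
        by linarith [(hX01 ω).2, (hα01 ω).1]⟩) (aY ω)) hD
    have h2 := integral_mul_eq_of_condExp_ae_eq hm (g := fun ω => q ω * δ ω) 1
      (by fun_prop) (fun ω => m2 (aq ω) (hδ1 ω)) (hI hX0 aX) hXα
    have hS' : S = ∫ ω, q ω * δ ω * (α ω * δ ω) ∂P := by
      rw [hS]; congr 1; funext ω; ring
    rw [hS', h1]
    have i1 : Integrable (fun ω => q ω * δ ω * (Y ω - 1 / 2) * X ω) P :=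
      hI (by fun_prop) fun ω => m2 (m2 (m2 (aq ω) (hδ1 ω)) (aY2 ω)) (aX ω)
    have i2 : Integrable (fun ω => q ω * δ ω * (Y ω - 1 / 2) * α ω) P :=
      hI (by fun_prop) fun ω => m2 (m2 (m2 (aq ω) (hδ1 ω)) (aY2 ω)) (aα ω)
    have i3 : Integrable (fun ω => q ω * δ ω * X ω) P :=
      hI (by fun_prop) fun ω => m2 (m2 (aq ω) (hδ1 ω)) (aX ω)
    have i4 : Integrable (fun ω => q ω * δ ω * α ω) P :=
      hI (by fun_prop) fun ω => m2 (m2 (aq ω) (hδ1 ω)) (aα ω)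
    have h3 : ∫ ω, q ω * δ ω * ((X ω - α ω) * Y ω) ∂P
        = ∫ ω, ((q ω * δ ω * (Y ω - 1 / 2) * X ω - q ω * δ ω * (Y ω - 1 / 2) * α ω)
          + (1 / 2) * (q ω * δ ω * X ω - q ω * δ ω * α ω)) ∂P := by
      congr 1; funext ω; ring
    have i5 : Integrable (fun ω => q ω * δ ω * (Y ω - 1 / 2) * X ω
        - q ω * δ ω * (Y ω - 1 / 2) * α ω) P := i1.sub i2
    have i6 : Integrable (fun ω => (1 / 2) * (q ω * δ ω * X ω - q ω * δ ω * α ω)) P :=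
      (i3.sub i4).const_mul _
    rw [h3, integral_add i5 i6, integral_sub i1 i2, integral_const_mul, integral_sub i3 i4, h2]
    ring
  have e4 : ∫ ω, W ω * δ ω ^ 2 * β ω ∂P = S := by
    rw [integral_mul_eq_of_condExp_ae_eq hm' (f := X) (g := fun ω => W ω * δ ω ^ 2) 1
      (by fun_prop) (fun ω => m2 (aW ω) (p2 (hδ1 ω))) (hI hX0 aX) hXβ]
    have := integral_mul_eq_of_condExp_ae_eq hn (g := fun ω => δ ω ^ 2 * X ω) 1
      (by fun_prop) (fun ω => m2 (p2 (hδ1 ω)) (aX ω)) (hI hW0 aW) hWq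
    rw [hS, integral_mul_eq_of_condExp_ae_eq hm (f := X) (g := fun ω => q ω * δ ω ^ 2) 1
      (by fun_prop) (fun ω => m2 (aq ω) (p2 (hδ1 ω))) (hI hX0 aX) hXα]
    convert this.symm using 3 <;> ring
  have e5 : ∫ ω, W ω * δ ω ^ 2 * α ω ∂P = S := by
    have := integral_mul_eq_of_condExp_ae_eq hn (g := fun ω => δ ω ^ 2 * α ω) 1
      (by fun_prop) (fun ω => m2 (p2 (hδ1 ω)) (aα ω)) (hI hW0 aW) hWq
    rw [hS]
    convert this.symm using 3 <;> ring
  have e6 : ∫ ω, β ω ∂P = ∫ ω, α ω ∂P := by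
    rw [← integral_congr_ae hXα, ← integral_congr_ae hXβ, integral_condExp hm,
      integral_condExp hm']
  -- Comparing `β` with `α + ε` keeps the reference positive and its logarithm bounded where `α`
  -- vanishes.
  have key : ∀ ε : ℝ, 0 < ε → ε ≤ 1 →
      2 * S ≤ (∫ ω, β ω * Real.log (β ω) ∂P) - (∫ ω, α ω * Real.log (α ω) ∂P) + 5 * ε := by
    intro ε hε hε1
    have hlogC : ∀ ω, |Real.log (α ω + ε)| ≤ |Real.log ε| + 1 := by
      intro ω
      have h1 : Real.log ε ≤ Real.log (α ω + ε) :=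
        Real.log_le_log hε (by linarith [(hα01 ω).1])
      have h2 : Real.log (α ω + ε) ≤ α ω + ε - 1 :=
        Real.log_le_sub_one_of_pos (by linarith [(hα01 ω).1])
      have h3 := neg_abs_le (Real.log ε)
      have h4 := abs_nonneg (Real.log ε)
      exact abs_le.2 ⟨by linarith, by linarith [(hα01 ω).2]⟩
    have ilog : ∀ {f : Ω → ℝ}, Measurable f → (∀ ω, |f ω| ≤ 1) →
        Integrable (fun ω => f ω * Real.log (α ω + ε)) P := fun hf h =>
      (hI hf h).mul_bdd (by fun_prop : Measurable fun ω => Real.log (α ω + ε)).aestronglyMeasurable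
        (ae_of_all _ hlogC)
    -- The logarithm is `m`-measurable, so `α` and `β` can both be replaced by `X`.
    have e7 : ∫ ω, β ω * Real.log (α ω + ε) ∂P = ∫ ω, α ω * Real.log (α ω + ε) ∂P := by
      have h1 := integral_mul_eq_of_condExp_ae_eq hm (g := fun ω => Real.log (α ω + ε)) _
        (by fun_prop) hlogC (hI hX0 aX) hXα
      have h2 := integral_mul_eq_of_condExp_ae_eq hm' (g := fun ω => Real.log (α ω + ε)) _
        (by fun_prop) hlogC (hI hX0 aX) hXβ
      simp_rw [mul_comm _ (Real.log (α _ + ε))]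
      rw [h1, h2]
    have e8 : ∫ ω, α ω * Real.log (α ω) ∂P ≤ ∫ ω, α ω * Real.log (α ω + ε) ∂P := by
      refine integral_mono iαlog (ilog hα0 aα) fun ω => ?_
      rcases (hα01 ω).1.eq_or_lt with h0 | h0
      · simp [← h0]
      · exact mul_le_mul_of_nonneg_left (Real.log_le_log h0 (by linarith)) h0.le
    set A := fun ω => W ω * δ ω * (Y ω - 1 / 2) * β ω with hA
    set A' := fun ω => W ω * δ ω * (Y ω - 1 / 2) * α ω with hA'
    set A'' := fun ω => W ω * δ ω * (Y ω - 1 / 2) with hA''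
    set B := fun ω => W ω * δ ω ^ 2 * β ω with hB
    set B' := fun ω => W ω * δ ω ^ 2 * α ω with hB'
    have iA : Integrable A P := hI (by fun_prop) fun ω => m2 (m2 (m2 (aW ω) (hδ1 ω)) (aY2 ω)) (aβ ω)
    have iA' : Integrable A' P :=
      hI (by fun_prop) fun ω => m2 (m2 (m2 (aW ω) (hδ1 ω)) (aY2 ω)) (aα ω)
    have iB : Integrable B P := hI (by fun_prop) fun ω => m2 (m2 (aW ω) (p2 (hδ1 ω))) (aβ ω)
    have iB' : Integrable B' P := hI (by fun_prop) fun ω => m2 (m2 (aW ω) (p2 (hδ1 ω))) (aα ω)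
    have iβ : Integrable β P := hI hβ0 aβ
    have iα : Integrable α P := hI hα0 aα
    have iβl := ilog hβ0 aβ
    -- The linearized inequality is multiplied by `W`, and `W` is then dropped from the nonnegative
    -- divergence term. Replacing `α` by `α + ε` costs at most `2ε + (4/3)ε + ε ≤ 5ε`.
    have hpt : ∀ ω, 4 * (A ω - A' ω) ≤
        (1 / 3) * (2 * B ω + 4 * B' ω) + (β ω * Real.log (β ω) - β ω * Real.log (α ω + ε)
          - β ω + α ω) + 5 * ε := by
      intro ω
      have hx : 0 < α ω + ε := by linarith [(hα01 ω).1]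
      have h1 := linear_le_sq_add_klDiv (d := δ ω) hx (hβ01 ω).1 (hY01 ω).1 (hY01 ω).2
      have h2 := klDiv_pointwise_nonneg hx (hβ01 ω).1
      have h3 := mul_le_mul_of_nonneg_left h1 (hW01 ω).1
      have h4 := mul_le_mul_of_nonneg_right (hW01 ω).2 h2
      have h5 : -1 ≤ A'' ω := (abs_le.1 (m2 (m2 (aW ω) (hδ1 ω)) (aY2 ω))).1
      have h5' : A'' ω ≤ 1 / 2 := by
        have : |A'' ω| ≤ 1 * (1 / 2) := by
          rw [hA'']
          simp only
          rw [abs_mul]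
          refine mul_le_mul (m2 (aW ω) (hδ1 ω)) ?_ (abs_nonneg _) one_pos.le
          exact abs_le.2 ⟨by linarith [(hY01 ω).1], by linarith [(hY01 ω).2]⟩
        linarith [le_abs_self (A'' ω)]
      have h6 : W ω * δ ω ^ 2 ≤ 1 := (abs_le.1 (m2 (aW ω) (p2 (hδ1 ω)))).2
      have h7 := mul_le_mul_of_nonneg_left h5' hε.le
      have h8 := mul_le_mul_of_nonneg_left h6 hε.le
      simp only [hA, hA', hA'', hB, hB'] at *
      linarith
    have j1 : Integrable (fun ω => 2 * B ω + 4 * B' ω) P := (iB.const_mul 2).add (iB'.const_mul 4)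
    have j2 : Integrable (fun ω => β ω * Real.log (β ω) - β ω * Real.log (α ω + ε)) P :=
      iβlog.sub iβl
    have j3 : Integrable (fun ω => β ω * Real.log (β ω) - β ω * Real.log (α ω + ε) - β ω) P :=
      j2.sub iβ
    have j4 : Integrable (fun ω => β ω * Real.log (β ω) - β ω * Real.log (α ω + ε) - β ω + α ω) P :=
      j3.add iα
    have j5 : Integrable (fun ω => (1 / 3) * (2 * B ω + 4 * B' ω)
        + (β ω * Real.log (β ω) - β ω * Real.log (α ω + ε) - β ω + α ω)) P :=
      (j1.const_mul _).add j4
    have hint := integral_mono ((iA.sub iA').const_mul 4) (j5.add (integrable_const (5 * ε))) hpt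
    simp only [Pi.add_apply, Pi.sub_apply] at hint
    rw [integral_const_mul, integral_sub iA iA', integral_add j5 (integrable_const _),
      integral_add (j1.const_mul _) j4, integral_const_mul,
      integral_add (iB.const_mul 2) (iB'.const_mul 4), integral_const_mul, integral_const_mul,
      integral_add j3 iα, integral_sub j2 iβ, integral_sub iβlog iβl, integral_const] at hint
    rw [e1, e2, e3, e4, e5, e6, e7] at hint
    simp at hint
    linarith
  refine le_of_forall_pos_le_add fun ε hε => ?_
  have h := key (min (ε / 5) 1) (by positivity) (min_le_right _ _)
  linarith [min_le_left (ε / 5) 1]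

/-! ### Versions of conditional expectations with bounds holding everywhere. -/

/-- The truncation of a real number to `[0,1]`. -/
def clampUnit (x : ℝ) : ℝ := max 0 (min 1 x)

theorem clampUnit_mem (x : ℝ) : clampUnit x ∈ Set.Icc (0 : ℝ) 1 :=
  ⟨le_max_left _ _, max_le zero_le_one (min_le_left _ _)⟩

theorem clampUnit_of_mem {x : ℝ} (h : x ∈ Set.Icc (0 : ℝ) 1) : clampUnit x = x := by
  rw [clampUnit, min_eq_right h.2, max_eq_right h.1]

theorem measurable_clampUnit : Measurable clampUnit := by
  unfold clampUnit
  fun_prop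

theorem condExp_mem_Icc {Ω : Type*} {m m0 : MeasurableSpace Ω} {P : Measure Ω}
    [IsProbabilityMeasure P] (hm : m ≤ m0) {X : Ω → ℝ} (hX : Measurable X)
    (hX01 : ∀ ω, X ω ∈ Set.Icc (0 : ℝ) 1) : ∀ᵐ ω ∂P, (P[X|m]) ω ∈ Set.Icc (0 : ℝ) 1 := by
  have iX : Integrable X P := integrable_of_measurable_of_abs_le 1 hX fun ω =>
    abs_le.2 ⟨by linarith [(hX01 ω).1], (hX01 ω).2⟩
  have h0 : 0 ≤ᵐ[P] P[X|m] := condExp_nonneg (ae_of_all _ fun ω => (hX01 ω).1)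
  have h1 : P[X|m] ≤ᵐ[P] P[fun _ => (1 : ℝ)|m] :=
    condExp_mono iX (integrable_const _) (ae_of_all _ fun ω => (hX01 ω).2)
  rw [condExp_const hm] at h1
  filter_upwards [h0, h1] with ω a b using ⟨a, b⟩

/-- The conditional covariance of `X` and `Y` is a bounded multiple of the conditional mean
of `X`. -/
theorem exists_condExp_centered_mul_eq {Ω : Type*} {m m0 : MeasurableSpace Ω} {P : Measure Ω}
    [IsProbabilityMeasure P] (hm : m ≤ m0) {X Y α : Ω → ℝ} (hX : Measurable X) (hY : Measurable Y)
    (hα : Measurable[m] α)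
    (hX01 : ∀ ω, X ω ∈ Set.Icc (0 : ℝ) 1) (hY01 : ∀ ω, Y ω ∈ Set.Icc (0 : ℝ) 1)
    (hα01 : ∀ ω, α ω ∈ Set.Icc (0 : ℝ) 1) (hXα : P[X|m] =ᵐ[P] α) :
    ∃ δ : Ω → ℝ, Measurable[m] δ ∧ (∀ ω, |δ ω| ≤ 1) ∧
      P[fun ω => (X ω - α ω) * Y ω|m] =ᵐ[P] fun ω => α ω * δ ω := by
  have hα0 := hα.mono hm le_rfl
  have bd : ∀ ω, -α ω ≤ (X ω - α ω) * Y ω ∧ (X ω - α ω) * Y ω ≤ X ω := fun ω => by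
    have := hX01 ω; have := hY01 ω; have := hα01 ω
    simp only [Set.mem_Icc] at *
    constructor <;> nlinarith
  have iX : Integrable X P := integrable_of_measurable_of_abs_le 1 hX fun ω =>
    abs_le.2 ⟨by linarith [(hX01 ω).1], (hX01 ω).2⟩
  have iα : Integrable α P := integrable_of_measurable_of_abs_le 1 hα0 fun ω =>
    abs_le.2 ⟨by linarith [(hα01 ω).1], (hα01 ω).2⟩
  have iD : Integrable (fun ω => (X ω - α ω) * Y ω) P :=
    integrable_of_measurable_of_abs_le 1 (by fun_prop) fun ω =>
      abs_le.2 ⟨by linarith [(bd ω).1, (hα01 ω).2], (bd ω).2.trans (hX01 ω).2⟩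
  set D := P[fun ω => (X ω - α ω) * Y ω|m] with hD
  have hDm : Measurable[m] D := stronglyMeasurable_condExp.measurable
  have h1 : D ≤ᵐ[P] P[X|m] := condExp_mono iD iX (ae_of_all _ fun ω => (bd ω).2)
  have h2 : P[-α|m] ≤ᵐ[P] D := condExp_mono iα.neg iD (ae_of_all _ fun ω => (bd ω).1)
  rw [condExp_of_stronglyMeasurable hm hα.neg.stronglyMeasurable iα.neg] at h2
  -- Almost surely `-α ≤ D ≤ α`, so the clipping changes nothing where `α > 0`, and `D = 0` where `α
  -- = 0`.
  refine ⟨fun ω => max (-1) (min 1 (D ω / α ω)), by fun_prop, fun ω => abs_le.2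
    ⟨le_max_left _ _, max_le (by norm_num) (min_le_left _ _)⟩, ?_⟩
  filter_upwards [h1, h2, hXα] with ω h1 h2 h3
  rw [h3] at h1
  simp only [Pi.neg_apply] at h2
  rcases (hα01 ω).1.eq_or_lt with h0 | h0
  · rw [← h0] at h1 h2 ⊢
    linarith
  · rw [min_eq_right ((div_le_one h0).2 h1), max_eq_right ((le_div_iff₀ h0).2 (by linarith)),
      mul_div_cancel₀ _ h0.ne']

/-! ### Bandit model: measurability, posteriors and observation probabilities. -/

namespace GraphBandit

variable {K : ℕ} {Ω : Type*}

/-- The indicator of `{A* = a}`. -/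
def optInd (B : GraphBandit K Ω) (a : Fin K) : Ω → ℝ :=
  (B.optAction ⁻¹' {a}).indicator fun _ => 1

/-- The indicator of `{A_t = a}`. -/
def actInd (B : GraphBandit K Ω) (t : ℕ) (a : Fin K) : Ω → ℝ :=
  (B.action t ⁻¹' {a}).indicator fun _ => 1

open Classical in
/-- The indicator of the event that the reward of `a` is observed in round `t`. -/
def obsInd (B : GraphBandit K Ω) (t : ℕ) (a : Fin K) (ω : Ω) : ℝ :=
  if (B.graph t).Adj (B.action t ω) a then 1 else 0

theorem indicator_one_mem_Icc {Ω : Type*} (s : Set Ω) (ω : Ω) :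
    s.indicator (fun _ => (1 : ℝ)) ω ∈ Set.Icc (0 : ℝ) 1 := by
  by_cases h : ω ∈ s <;> simp [h]

theorem hist_mono (B : GraphBandit K Ω) (t : ℕ) : B.hist t ≤ B.hist (t + 1) :=
  iSup_le fun s => le_iSup (fun s : Fin (t + 1) =>
    MeasurableSpace.comap (B.observation s) inferInstance) s.castSucc

theorem measurable_observation_hist (B : GraphBandit K Ω) (t : ℕ) :
    Measurable[B.hist (t + 1)] (B.observation t) :=
  measurable_iff_comap_le.2 (le_iSup (fun s : Fin (t + 1) =>
    MeasurableSpace.comap (B.observation s) inferInstance) (Fin.last t))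

theorem measurable_reward_env (B : GraphBandit K Ω) (t : ℕ) (a : Fin K) :
    Measurable[B.sigmaEnv] fun ω => (B.reward t ω a : ℝ) := by
  have h : Measurable[B.sigmaEnv] (B.reward t) := measurable_iff_comap_le.2
    ((le_iSup (fun s => MeasurableSpace.comap (B.reward s) inferInstance) t).trans le_sup_right)
  exact measurable_subtype_coe.comp ((measurable_pi_apply a).comp h)

theorem measurable_obsInd_hist (B : GraphBandit K Ω) (t : ℕ) (a : Fin K) :
    Measurable[B.hist (t + 1)] (B.obsInd t a) := by
  classical
  have h : Measurable fun i : Fin K => if (B.graph t).Adj i a then (1 : ℝ) else 0 :=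
    Measurable.of_discrete
  have h2 := (h.comp measurable_fst).comp (measurable_observation_hist B t)
  convert h2 using 1
  funext ω
  simp [obsInd, observation]

/-- The masked reward is exactly the entry recorded by `observation`, whose filler is `0`. -/
theorem measurable_obsInd_mul_hist (B : GraphBandit K Ω) (t : ℕ) (a : Fin K) :
    Measurable[B.hist (t + 1)] fun ω => B.obsInd t a ω * (B.reward t ω a : ℝ) := by
  have h := (measurable_subtype_coe.comp ((measurable_pi_apply a).comp measurable_snd)).comp
    (measurable_observation_hist B t)
  convert h using 1
  funext ω
  by_cases hadj : (B.graph t).Adj (B.action t ω) a <;> simp [obsInd, observation, hadj]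

theorem obsInd_mem_Icc (B : GraphBandit K Ω) (t : ℕ) (a : Fin K) (ω : Ω) :
    B.obsInd t a ω ∈ Set.Icc (0 : ℝ) 1 := by
  unfold obsInd
  split_ifs <;> simp

variable [m0 : MeasurableSpace Ω] {P : Measure Ω} {B : GraphBandit K Ω}

/-- The version of the posterior with all its values in `[0,1]`. -/
def post (B : GraphBandit K Ω) (P : Measure Ω) (t : ℕ) (a : Fin K) (ω : Ω) : ℝ :=
  clampUnit (B.posterior P t a ω)

open Classical in
/-- The conditional probability that the reward of `a` is observed in round `t`, with all its
values in `[0,1]`. -/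
def obsProb (B : GraphBandit K Ω) (P : Measure Ω) (t : ℕ) (a : Fin K) (ω : Ω) : ℝ :=
  clampUnit (∑ j ∈ Finset.univ.filter (fun j => (B.graph t).Adj j a), B.posterior P t j ω)

/-- The expected entropy of the posterior. -/
def expEntropy (B : GraphBandit K Ω) (P : Measure Ω) (t : ℕ) : ℝ :=
  -∑ a, ∫ ω, B.post P t a ω * Real.log (B.post P t a ω) ∂P

theorem measurable_observation (hB : B.IsBayesian P) (t : ℕ) : Measurable (B.observation t) := by
  classical
  refine (hB.measurable_action t).prodMk (measurable_pi_lambda _ fun a => ?_)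
  refine Measurable.ite ?_ ((measurable_pi_apply a).comp (hB.measurable_reward t))
    measurable_const
  exact hB.measurable_action t (MeasurableSet.of_discrete (s := {i | (B.graph t).Adj i a}))

theorem hist_le (hB : B.IsBayesian P) (t : ℕ) : B.hist t ≤ m0 :=
  iSup_le fun s => (measurable_observation hB s).comap_le

theorem sigmaEnv_le (hB : B.IsBayesian P) : B.sigmaEnv ≤ m0 :=
  sup_le hB.measurable_pstar.comap_le (iSup_le fun s => (hB.measurable_reward s).comap_le)

theorem measurable_optInd_env (hB : B.IsBayesian P) (a : Fin K) :
    Measurable[B.sigmaEnv] (B.optInd a) :=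
  (measurable_const.indicator (hB.measurable_optAction (measurableSet_singleton a))).mono
    le_sup_left le_rfl

theorem measurable_posterior (B : GraphBandit K Ω) (P : Measure Ω) (t : ℕ) (a : Fin K) :
    Measurable[B.hist t] (B.posterior P t a) :=
  stronglyMeasurable_condExp.measurable

theorem measurable_post (B : GraphBandit K Ω) (P : Measure Ω) (t : ℕ) (a : Fin K) :
    Measurable[B.hist t] (B.post P t a) :=
  measurable_clampUnit.comp (measurable_posterior B P t a)

theorem measurable_obsProb (B : GraphBandit K Ω) (P : Measure Ω) (t : ℕ) (a : Fin K) :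
    Measurable[B.hist t] (B.obsProb P t a) :=
  measurable_clampUnit.comp (Finset.measurable_fun_sum _ fun j _ => measurable_posterior B P t j)

theorem measurable_obsInd (hB : B.IsBayesian P) (t : ℕ) (a : Fin K) : Measurable (B.obsInd t a) :=
  (measurable_obsInd_hist B t a).mono (hist_le hB _) le_rfl

theorem measurable_actInd (hB : B.IsBayesian P) (t : ℕ) (a : Fin K) : Measurable (B.actInd t a) :=
  measurable_const.indicator (hB.measurable_action t (measurableSet_singleton a))

theorem expEntropy_nonneg (B : GraphBandit K Ω) (P : Measure Ω) (t : ℕ) : 0 ≤ B.expEntropy P t := by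
  rw [expEntropy, neg_nonneg]
  refine Finset.sum_nonpos fun a _ => integral_nonpos fun ω => ?_
  have h : B.post P t a ω ∈ Set.Icc (0 : ℝ) 1 := clampUnit_mem _
  exact mul_nonpos_of_nonneg_of_nonpos h.1 (Real.log_nonpos h.1 h.2)

variable [IsProbabilityMeasure P]

theorem posterior_mem_Icc (hB : B.IsBayesian P) (t : ℕ) (a : Fin K) :
    ∀ᵐ ω ∂P, B.posterior P t a ω ∈ Set.Icc (0 : ℝ) 1 :=
  condExp_mem_Icc (hist_le hB t)
    ((measurable_optInd_env hB a).mono (sigmaEnv_le hB) le_rfl) (indicator_one_mem_Icc _)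

theorem posterior_ae_eq_post (hB : B.IsBayesian P) (t : ℕ) (a : Fin K) :
    B.posterior P t a =ᵐ[P] B.post P t a := by
  filter_upwards [posterior_mem_Icc hB t a] with ω h using (clampUnit_of_mem h).symm

theorem integrable_actInd (hB : B.IsBayesian P) (t : ℕ) (a : Fin K) :
    Integrable (B.actInd t a) P :=
  (integrable_const 1).indicator (hB.measurable_action t (measurableSet_singleton a))

open Classical in
-- The reward of `a` is revealed when the action played is an in-neighbour of `a`. Given the
-- history, the environment does not affect this probability, which is the denominator in `graphQ`.
theorem condExp_obsInd_ae_eq_sum (hB : B.IsBayesian P) (hTS : B.IsTSN P) (t : ℕ) (a : Fin K) :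
    P[B.obsInd t a|B.hist t ⊔ B.sigmaEnv] =ᵐ[P] fun ω =>
      ∑ j ∈ Finset.univ.filter (fun j => (B.graph t).Adj j a), B.posterior P t j ω := by
  have h1 : B.obsInd t a
      = ∑ j ∈ Finset.univ.filter (fun j => (B.graph t).Adj j a), B.actInd t j := by
    funext ω
    simp [obsInd, actInd, Set.indicator_apply, Finset.sum_ite_eq, Finset.sum_apply]
  rw [h1]
  have hs : ∀ᵐ ω ∂P, ∀ j, (P[B.actInd t j|B.hist t ⊔ B.sigmaEnv]) ω = B.posterior P t j ω :=
    ae_all_iff.2 fun j => hTS.sampled t j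
  filter_upwards [condExp_finsetSum (fun j _ => integrable_actInd hB t j)
    (B.hist t ⊔ B.sigmaEnv), hs] with ω h2 h3
  rw [h2, Finset.sum_apply]
  exact Finset.sum_congr rfl fun j _ => h3 j

open Classical in
theorem sum_posterior_ae_eq_obsProb (hB : B.IsBayesian P) (hTS : B.IsTSN P) (t : ℕ) (a : Fin K) :
    (fun ω => ∑ j ∈ Finset.univ.filter (fun j => (B.graph t).Adj j a), B.posterior P t j ω)
      =ᵐ[P] B.obsProb P t a := by
  filter_upwards [condExp_obsInd_ae_eq_sum hB hTS t a,
    condExp_mem_Icc (P := P) (sup_le (hist_le hB t) (sigmaEnv_le hB)) (measurable_obsInd hB t a)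
      (obsInd_mem_Icc B t a)] with ω h1 h2
  rw [h1] at h2
  exact (clampUnit_of_mem h2).symm

/-- By the self-loop, `a` is one of its own in-neighbours. Hence `α/q ≤ 1`, and `q > 0` wherever `α
> 0`. -/
theorem post_le_obsProb (hB : B.IsBayesian P) (hTS : B.IsTSN P) (t : ℕ) (a : Fin K) :
    ∀ᵐ ω ∂P, B.post P t a ω ≤ B.obsProb P t a ω := by
  classical
  have h0 : ∀ᵐ ω ∂P, ∀ j, B.posterior P t j ω ∈ Set.Icc (0 : ℝ) 1 :=
    ae_all_iff.2 fun j => posterior_mem_Icc hB t j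
  filter_upwards [sum_posterior_ae_eq_obsProb hB hTS t a, posterior_ae_eq_post hB t a, h0]
    with ω h1 h2 h3
  rw [← h1, ← h2]
  exact Finset.single_le_sum (f := fun j => B.posterior P t j ω) (fun j _ => (h3 j).1)
    (by simp [hB.adj_self])

theorem graphQ_posterior_ae_eq (hB : B.IsBayesian P) (hTS : B.IsTSN P) (t : ℕ) :
    (fun ω => graphQ (B.graph t) fun a => B.posterior P t a ω)
      =ᵐ[P] fun ω => ∑ a, B.post P t a ω / B.obsProb P t a ω := by
  have h1 := ae_all_iff.2 fun a => sum_posterior_ae_eq_obsProb hB hTS t a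
  have h2 := ae_all_iff.2 fun a => posterior_ae_eq_post hB t a
  filter_upwards [h1, h2] with ω h1 h2
  exact Finset.sum_congr rfl fun a _ => by simp only [h1 a, h2 a]

theorem integrable_post_div_obsProb (hB : B.IsBayesian P) (hTS : B.IsTSN P) (t : ℕ) (a : Fin K) :
    Integrable (fun ω => B.post P t a ω / B.obsProb P t a ω) P := by
  have h1 := (measurable_post B P t a).mono (hist_le hB t) le_rfl
  have h2 := (measurable_obsProb B P t a).mono (hist_le hB t) le_rfl
  refine Integrable.of_bound (h1.div h2).aestronglyMeasurable 1 ?_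
  filter_upwards [post_le_obsProb hB hTS t a] with ω h
  have h3 : 0 ≤ B.post P t a ω := (clampUnit_mem _).1
  rw [Real.norm_of_nonneg (div_nonneg h3 (h3.trans h))]
  exact div_le_one_of_le₀ h (h3.trans h)

/-! ### Regret of a single round. -/

/-- Testing the sampling rule of Thompson sampling against a function of the environment. -/
theorem integral_actInd_mul_reward (hB : B.IsBayesian P) (hTS : B.IsTSN P) (t : ℕ) (a : Fin K) :
    ∫ ω, B.actInd t a ω * (B.reward t ω a : ℝ) ∂P
      = ∫ ω, B.post P t a ω * (B.reward t ω a : ℝ) ∂P := by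
  have h := integral_mul_eq_of_condExp_ae_eq (P := P) (sup_le (hist_le hB t) (sigmaEnv_le hB))
    (g := fun ω => (B.reward t ω a : ℝ)) 1
    ((measurable_reward_env B t a).mono le_sup_right le_rfl)
    (fun ω => abs_le.2 ⟨by linarith [(B.reward t ω a).2.1], (B.reward t ω a).2.2⟩)
    (integrable_actInd hB t a) ((hTS.sampled t a).trans (posterior_ae_eq_post hB t a))
  simp_rw [mul_comm _ ((B.reward t _ a : ℝ))]
  exact h.symm

/-- One round: the regret against the graph quantity and the entropy reduction. -/
theorem integral_regret_le (hB : B.IsBayesian P) (hTS : B.IsTSN P) (t : ℕ) {c : ℝ} (hc : 0 < c) :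
    ∫ ω, ((B.reward t ω (B.optAction ω) : ℝ) - (B.reward t ω (B.action t ω) : ℝ)) ∂P ≤
      c / 2 * ∫ ω, graphQ (B.graph t) (fun a => B.posterior P t a ω) ∂P
        + (B.expEntropy P t - B.expEntropy P (t + 1)) / (4 * c) := by
  have hm := hist_le hB t
  have hEnv := sigmaEnv_le hB
  have mX : ∀ a, Measurable (B.optInd a) := fun a => (measurable_optInd_env hB a).mono hEnv le_rfl
  have mY : ∀ a, Measurable fun ω => (B.reward t ω a : ℝ) :=
    fun a => (measurable_reward_env B t a).mono hEnv le_rfl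
  have mα : ∀ a, Measurable (B.post P t a) := fun a => (measurable_post B P t a).mono hm le_rfl
  have mq : ∀ a, Measurable (B.obsProb P t a) :=
    fun a => (measurable_obsProb B P t a).mono hm le_rfl
  have X01 : ∀ a ω, B.optInd a ω ∈ Set.Icc (0 : ℝ) 1 := fun a ω => indicator_one_mem_Icc _ _
  have Z01 : ∀ a ω, B.actInd t a ω ∈ Set.Icc (0 : ℝ) 1 := fun a ω => indicator_one_mem_Icc _ _
  have Y01 : ∀ a ω, (B.reward t ω a : ℝ) ∈ Set.Icc (0 : ℝ) 1 := fun a ω => (B.reward t ω a).2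
  have α01 : ∀ a ω, B.post P t a ω ∈ Set.Icc (0 : ℝ) 1 := fun a ω => clampUnit_mem _
  have q01 : ∀ a ω, B.obsProb P t a ω ∈ Set.Icc (0 : ℝ) 1 := fun a ω => clampUnit_mem _
  have ab : ∀ {x : ℝ}, x ∈ Set.Icc (0 : ℝ) 1 → |x| ≤ 1 := fun h =>
    abs_le.2 ⟨by linarith [h.1], h.2⟩
  have m2 : ∀ {x y : ℝ}, |x| ≤ 1 → |y| ≤ 1 → |x * y| ≤ 1 := fun hx hy => by
    rw [abs_mul]; exact mul_le_one₀ hx (abs_nonneg _) hy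
  have hI : ∀ {f : Ω → ℝ}, Measurable f → (∀ ω, |f ω| ≤ 1) → Integrable f P :=
    fun hf h => integrable_of_measurable_of_abs_le 1 hf h
  have hδ : ∀ a, ∃ δ : Ω → ℝ, Measurable[B.hist t] δ ∧ (∀ ω, |δ ω| ≤ 1) ∧
      P[fun ω => (B.optInd a ω - B.post P t a ω) * (B.reward t ω a : ℝ)|B.hist t]
        =ᵐ[P] fun ω => B.post P t a ω * δ ω := fun a =>
    exists_condExp_centered_mul_eq hm (mX a) (mY a) (measurable_post B P t a) (X01 a) (Y01 a)
      (α01 a) (posterior_ae_eq_post hB t a)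
  choose δ δm δ1 δD using hδ
  have mδ : ∀ a, Measurable (δ a) := fun a => (δm a).mono hm le_rfl
  have hstep : ∀ a, 2 * ∫ ω, B.obsProb P t a ω * δ a ω ^ 2 * B.post P t a ω ∂P ≤
      (∫ ω, B.post P (t + 1) a ω * Real.log (B.post P (t + 1) a ω) ∂P)
        - ∫ ω, B.post P t a ω * Real.log (B.post P t a ω) ∂P := fun a =>
    two_mul_integral_sq_le_entropy_increment (n := B.hist t ⊔ B.sigmaEnv) (hist_mono B t)
      (hist_le hB (t + 1)) le_sup_left (sup_le hm hEnv)
      ((measurable_optInd_env hB a).mono le_sup_right le_rfl)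
      ((measurable_reward_env B t a).mono le_sup_right le_rfl)
      (measurable_obsInd_hist B t a) (measurable_obsInd_mul_hist B t a)
      (measurable_obsProb B P t a) (measurable_post B P t a) (measurable_post B P (t + 1) a)
      (δm a) (X01 a) (Y01 a) (obsInd_mem_Icc B t a) (q01 a) (α01 a) (fun _ => clampUnit_mem _)
      (δ1 a)
      ((condExp_obsInd_ae_eq_sum hB hTS t a).trans (sum_posterior_ae_eq_obsProb hB hTS t a))
      (posterior_ae_eq_post hB t a) (posterior_ae_eq_post hB (t + 1) a) (δD a)
  have iXY : ∀ a, Integrable (fun ω => B.optInd a ω * (B.reward t ω a : ℝ)) P := fun a =>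
    hI ((mX a).mul (mY a)) fun ω => m2 (ab (X01 a ω)) (ab (Y01 a ω))
  have iZY : ∀ a, Integrable (fun ω => B.actInd t a ω * (B.reward t ω a : ℝ)) P := fun a =>
    hI ((measurable_actInd hB t a).mul (mY a)) fun ω => m2 (ab (Z01 a ω)) (ab (Y01 a ω))
  have iαY : ∀ a, Integrable (fun ω => B.post P t a ω * (B.reward t ω a : ℝ)) P := fun a =>
    hI ((mα a).mul (mY a)) fun ω => m2 (ab (α01 a ω)) (ab (Y01 a ω))
  have iαδ : ∀ a, Integrable (fun ω => B.post P t a ω * δ a ω) P := fun a =>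
    hI ((mα a).mul (mδ a)) fun ω => m2 (ab (α01 a ω)) (δ1 a ω)
  have iqδ : ∀ a, Integrable (fun ω => B.obsProb P t a ω * δ a ω ^ 2 * B.post P t a ω) P :=
    fun a => hI (((mq a).mul ((mδ a).pow_const 2)).mul (mα a)) fun ω =>
      m2 (m2 (ab (q01 a ω)) (by rw [sq]; exact m2 (δ1 a ω) (δ1 a ω))) (ab (α01 a ω))
  have idiv := fun a => integrable_post_div_obsProb hB hTS t a
  -- Sampling replaces the indicator of `A_t = a` by `α`; conditioning `(X - α) Y` on the history
  -- then produces `α δ`.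
  have hreg : ∫ ω, ((B.reward t ω (B.optAction ω) : ℝ) - (B.reward t ω (B.action t ω) : ℝ)) ∂P
      = ∑ a, ∫ ω, B.post P t a ω * δ a ω ∂P := by
    have h1 : ∀ ω, ((B.reward t ω (B.optAction ω) : ℝ) - (B.reward t ω (B.action t ω) : ℝ))
        = ∑ a, (B.optInd a ω * (B.reward t ω a : ℝ) - B.actInd t a ω * (B.reward t ω a : ℝ)) := by
      intro ω
      rw [Finset.sum_sub_distrib, Finset.sum_eq_single (B.optAction ω),
        Finset.sum_eq_single (B.action t ω)] <;> simp +contextual [optInd, actInd, eq_comm]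
    simp_rw [h1]
    rw [integral_finsetSum _ fun a _ => by exact (iXY a).sub (iZY a)]
    refine Finset.sum_congr rfl fun a _ => ?_
    rw [integral_sub (iXY a) (iZY a), integral_actInd_mul_reward hB hTS t a,
      ← integral_sub (iXY a) (iαY a), ← integral_congr_ae (δD a), integral_condExp hm]
    simp_rw [sub_mul]
  have hterm : ∀ a, ∫ ω, B.post P t a ω * δ a ω ∂P ≤
      c / 2 * (∫ ω, B.post P t a ω / B.obsProb P t a ω ∂P)
        + 1 / (2 * c) * ∫ ω, B.obsProb P t a ω * δ a ω ^ 2 * B.post P t a ω ∂P := by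
    intro a
    rw [← integral_const_mul, ← integral_const_mul,
      ← integral_add ((idiv a).const_mul _) ((iqδ a).const_mul _)]
    refine integral_mono_ae (iαδ a) (((idiv a).const_mul _).add ((iqδ a).const_mul _)) ?_
    filter_upwards [post_le_obsProb hB hTS t a] with ω h
    rcases (α01 a ω).1.eq_or_lt with h0 | h0
    · simp [← h0]
    · have hq : 0 < B.obsProb P t a ω := h0.trans_le h
      set x := B.post P t a ω
      set q := B.obsProb P t a ω
      set d := δ a ω
      have h1 : c / 2 * (x / q) + 1 / (2 * c) * (q * d ^ 2 * x) - x * d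
          = x * (c - q * d) ^ 2 / (2 * c * q) := by
        -- The AM-GM gap between `α δ` and its bound is a perfect square with a positive
        -- denominator.
        field_simp
        ring
      have h2 : 0 ≤ x * (c - q * d) ^ 2 / (2 * c * q) := by positivity
      linarith
  rw [hreg, integral_congr_ae (graphQ_posterior_ae_eq hB hTS t),
    integral_finsetSum _ fun a _ => idiv a]
  calc ∑ a, ∫ ω, B.post P t a ω * δ a ω ∂P
      ≤ ∑ a, (c / 2 * (∫ ω, B.post P t a ω / B.obsProb P t a ω ∂P)
        + ((∫ ω, B.post P (t + 1) a ω * Real.log (B.post P (t + 1) a ω) ∂P)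
        - ∫ ω, B.post P t a ω * Real.log (B.post P t a ω) ∂P) / (4 * c)) := by
        refine Finset.sum_le_sum fun a _ => (hterm a).trans ?_
        have h := mul_le_mul_of_nonneg_left (hstep a) (show 0 ≤ 1 / (4 * c) by positivity)
        have h1 : ∀ x : ℝ, 1 / (4 * c) * (2 * x) = 1 / (2 * c) * x := fun x => by
          field_simp; ring
        rw [h1] at h
        rw [div_eq_mul_one_div _ (4 * c), mul_comm _ (1 / (4 * c))]
        linarith
    _ = _ := by
        rw [Finset.sum_add_distrib, ← Finset.mul_sum, ← Finset.sum_div, Finset.sum_sub_distrib,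
          expEntropy, expEntropy]
        ring

/-! ### Initial entropy and summation over the rounds. -/

theorem expEntropy_zero (hB : B.IsBayesian P) :
    B.expEntropy P 0 = shannonEntropy (B.prior P) := by
  -- Before round `0` nothing has been observed, so conditioning on the history is plain
  -- expectation.
  have h0 : B.hist 0 = ⊥ := iSup_of_empty _
  have h1 : ∀ a ω, B.post P 0 a ω = B.prior P a := by
    intro a ω
    have hs : MeasurableSet (B.optAction ⁻¹' {a}) :=
      (le_sup_left.trans (sigmaEnv_le hB)) _
        (hB.measurable_optAction (measurableSet_singleton a))
    have h2 : B.posterior P 0 a ω = B.prior P a := by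
      rw [posterior, h0, condExp_bot, integral_indicator_const _ hs, prior]
      simp
    rw [post, h2]
    exact clampUnit_of_mem ⟨measureReal_nonneg, measureReal_le_one⟩
  simp [expEntropy, shannonEntropy, h1]

end GraphBandit

open GraphBandit in
theorem mainTheorem3 {K : ℕ} {Ω : Type*} [MeasurableSpace Ω] (P : Measure Ω)
    [IsProbabilityMeasure P] (B : GraphBandit K Ω) (hB : B.IsBayesian P) (hTS : B.IsTSN P)
    (T : ℕ) :
    B.bayesRegret P T ≤
      Real.sqrt ((1 / 2 : ℝ) *
        (∑ t ∈ Finset.range T, ∫ ω, graphQ (B.graph t) (fun a => B.posterior P t a ω) ∂P) *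
        shannonEntropy (B.prior P)) := by
  rw [← expEntropy_zero hB]
  refine le_sqrt_of_forall_pos_le (fun c hc => ?_) ?_ (expEntropy_nonneg B P 0)
  · have hint : ∀ t, Integrable (fun ω =>
        (B.reward t ω (B.optAction ω) : ℝ) - (B.reward t ω (B.action t ω) : ℝ)) P := by
      intro t
      have hr : ∀ f : Ω → Fin K, Measurable f → Measurable fun ω => (B.reward t ω (f ω) : ℝ) := by
        intro f hf
        have h : Measurable fun p : RewardVec K × Fin K => (p.1 p.2 : ℝ) :=
          measurable_from_prod_countable_left fun a =>
            measurable_subtype_coe.comp (measurable_pi_apply a)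
        exact h.comp ((hB.measurable_reward t).prodMk hf)
      refine integrable_of_measurable_of_abs_le 1
        ((hr _ (hB.measurable_optAction.mono (le_sup_left.trans (sigmaEnv_le hB)) le_rfl)).sub
          (hr _ (hB.measurable_action t))) fun ω => ?_
      have h1 := (B.reward t ω (B.optAction ω)).2
      have h2 := (B.reward t ω (B.action t ω)).2
      exact abs_le.2 ⟨by linarith [h1.1, h2.2], by linarith [h1.2, h2.1]⟩
    rw [bayesRegret, integral_finsetSum _ fun t _ => hint t]
    refine (Finset.sum_le_sum fun t _ => integral_regret_le hB hTS t hc).trans ?_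
    -- The entropy drops telescope, and the final entropy, being nonnegative, is discarded.
    rw [Finset.sum_add_distrib, ← Finset.mul_sum, ← Finset.sum_div, Finset.sum_range_sub']
    gcongr
    linarith [expEntropy_nonneg B P T]
  · refine Finset.sum_nonneg fun t _ => ?_
    rw [integral_congr_ae (graphQ_posterior_ae_eq hB hTS t)]
    exact integral_nonneg fun ω => Finset.sum_nonneg fun a _ =>
      div_nonneg (clampUnit_mem _).1 (clampUnit_mem _).1

end
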